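/- Let $\mu,\nu$ be Borel probability measures on $\mathbb R$ with finite first moments, $\mu$ without atoms, and let $\mathcal M(\mu,\nu)$ be the set of probability measures $\mathbb P$ on $\mathbb R\times\mathbb R$ with marginals $\mu$ and $\nu$ such that $\mathbb E^{\mathbb P}[Y|X]=X$, where $(X,Y)$ are the coordinate maps. Let $\mathbb P\in\mathcal M(\mu,\nu)$ be left-monotone, i.e. there is a Borel set $\Gamma$ with $\mathbb P[(X,Y)\in\Gamma]=1$ such that $y'\notin(y_0,y_1)$ whenever $(x,y_0),(x,y_1),(x',y')\in\Gamma$ and $x<x'$. Let $T_d,T_u:D\to\mathbb R$ be Borel maps on a Borel set $D\subseteq\mathbb R$ with $\mu(D)=1$ (for instance $D=\mathbb R$) which represent $\mathbb P$ on two graphs: for $x\in D$ one has $T_d(x)\le x\le T_u(x)$, and $T_d(x)=x$ if and only if $T_u(x)=x$; $$\mathbb P(dx,dy)=\mu(dx)\big[q(x)\delta_{T_u(x)}+(1-q(x))\delta_{T_d(x)}\big](dy),\qquad q(x)=\frac{x-T_d(x)}{T_u(x)-T_d(x)}\mathbf 1_{\{T_d(x)<T_u(x)\}};$$ $T_u$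 is non-decreasing on $D$; and $T_d(y)\notin(T_d(x),T_u(x))$ for all $x<y$ in $D$. Define $$R:=\bigcup_{i\in\{d,u\}}\ \bigcup_{x\in D}[T_i(x)-x,\infty)\times\{T_i(x)\}.$$ Let $B=(B_t)_{t\ge0}$ be a Brownian motion with respect to a filtration $(\mathcal F_t)_{t\ge0}$ on a probability space, started from $B_0\sim\mu$: $B$ is adapted, $B-B_0$ is a standard Brownian motion with almost surely continuous paths, and $B_t-B_s$ is independent of $\mathcal F_s$ for $s\le t$. Assume that every subset of the null set of those $\omega$ for which $t\mapsto B_t(\omega)$ is discontinuous or $B_0(\omega)\notin D$ belongs to $\mathcal F_0$ (this holds if $\mathcal F_0$ contains all null sets, and it is no restriction on the filtration if all paths are continuous and start in $D$). Let $$\tau_R:=\inf\{t\ge 0:\ (B_t-B_0,B_t)\in R\},\qquad \inf\emptyset=\infty .$$ Then the stopped process $(B_{t\wedge\tau_R})_{t\ge0}$ is a uniformly integrable $(\mathcal F_t)$-martingale. -/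

import Mathlib

open MeasureTheory ProbabilityTheory
open scoped NNReal ENNReal

namespace LeftMonotone

/-- `P ∈ 𝓜(μ, ν)`: `P` has marginals `μ` and `ν`, and `E^P[Y | X] = X`. -/
structure IsMartingaleCoupling (μ ν : Measure ℝ) (P : Measure (ℝ × ℝ)) : Prop where
  map_fst : P.map Prod.fst = μ
  map_snd : P.map Prod.snd = ν
  condExp_eq :
    P[(Prod.snd : ℝ × ℝ → ℝ) | MeasurableSpace.comap Prod.fst inferInstance] =ᵐ[P] Prod.fst

/-- Left-monotonicity of a transport plan. -/
def IsLeftMonotone (P : Measure (ℝ × ℝ)) : Prop :=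
  ∃ Γ : Set (ℝ × ℝ), MeasurableSet Γ ∧ P Γᶜ = 0 ∧
    ∀ x y₀ y₁ x' y' : ℝ, (x, y₀) ∈ Γ → (x, y₁) ∈ Γ → (x', y') ∈ Γ → x < x' →
      y' ∉ Set.Ioo y₀ y₁

open Classical in
/-- The weight `q(x) = (x - T_d(x)) / (T_u(x) - T_d(x))` if `T_d(x) < T_u(x)`, and `0` otherwise. -/
noncomputable def upWeight (Td Tu : ℝ → ℝ) (x : ℝ) : ℝ :=
  if Td x < Tu x then (x - Td x) / (Tu x - Td x) else 0

/-- The measure `μ(dx) [q(x) δ_{T_u(x)} + (1 - q(x)) δ_{T_d(x)}](dy)` on the plane. -/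
noncomputable def twoGraphPlan (μ : Measure ℝ) (Td Tu : ℝ → ℝ) : Measure (ℝ × ℝ) :=
  μ.bind fun x =>
    ENNReal.ofReal (upWeight Td Tu x) • Measure.dirac (x, Tu x) +
      ENNReal.ofReal (1 - upWeight Td Tu x) • Measure.dirac (x, Td x)

/-- `(T_d, T_u)`, defined on the Borel set `D` of full `μ`-measure, is a pair of maps representing
the plan `P` on two graphs. Only the values on `D` matter; `D = Set.univ` is allowed. -/
structure IsTransportPair (μ : Measure ℝ) (P : Measure (ℝ × ℝ)) (D : Set ℝ) (Td Tu : ℝ → ℝ) :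
    Prop where
  measurableSet_dom : MeasurableSet D
  dom_full : μ Dᶜ = 0
  measurable_down : Measurable Td
  measurable_up : Measurable Tu
  down_le : ∀ x ∈ D, Td x ≤ x
  le_up : ∀ x ∈ D, x ≤ Tu x
  eq_iff : ∀ x ∈ D, Td x = x ↔ Tu x = x
  plan_eq : P = twoGraphPlan μ Td Tu
  up_mono : ∀ x ∈ D, ∀ y ∈ D, x ≤ y → Tu x ≤ Tu y
  down_notMem : ∀ x ∈ D, ∀ y ∈ D, x < y → Td y ∉ Set.Ioo (Td x) (Tu x)

/-- `⋃_{x ∈ D} [T(x) - x, ∞) × {T(x)}`. -/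
def halfBarrier (D : Set ℝ) (T : ℝ → ℝ) : Set (ℝ × ℝ) :=
  ⋃ x ∈ D, Set.Ici (T x - x) ×ˢ {T x}

/-- The barrier `R = R_u ∪ R_d`. -/
def barrier (D : Set ℝ) (Td Tu : ℝ → ℝ) : Set (ℝ × ℝ) :=
  halfBarrier D Tu ∪ halfBarrier D Td

/-- `B` is a Brownian motion for the filtration `𝓕` with initial law `μ`. -/
structure IsBrownianMotionFrom {Ω : Type*} {mΩ : MeasurableSpace Ω} (μ : Measure ℝ)
    (B : ℝ≥0 → Ω → ℝ) (𝓕 : Filtration ℝ≥0 mΩ) (Q : Measure Ω) : Prop where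
  stronglyAdapted : StronglyAdapted 𝓕 B
  hasLaw_zero : HasLaw (B 0) μ Q
  isBrownian : IsBrownianReal (fun t ω => B t ω - B 0 ω) Q
  indep : ∀ s t : ℝ≥0, s ≤ t →
    Indep (MeasurableSpace.comap (fun ω => B t ω - B s ω) inferInstance) (𝓕 s) Q

/-- `τ_R = inf {t ≥ 0 : (B_t - B_0, B_t) ∈ R}`, with value `⊤` (infinity) if there is no such `t`. -/
noncomputable def barrierTime {Ω : Type*} (B : ℝ≥0 → Ω → ℝ) (R : Set (ℝ × ℝ)) : Ω → WithTop ℝ≥0 :=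
  hittingAfter (fun t ω => (B t ω - B 0 ω, B t ω)) R 0

end LeftMonotone

/-! For a start `x ∈ D`, the barrier contains the points `(y - x, y)` with `y = Td x` and `y = Tu
x`, but none with `y` strictly between: monotonicity of `Tu` and the condition on `Td` keep later
starts from interfering. So on continuous paths `τ_R` is the exit time from the open interval `(Td
(B 0), Tu (B 0))` (`IsTransportPair.lt_barrierTime_iff`), and the stopped process `Z` stays in its
closure.

The martingale property comes from independent increments: a stopped increment is the pathwise limit
of grid sums that keep an increment while the grid time precedes `τ_R`. These sums are bounded in L²
and orthogonal to bounded variables from the past, and orthogonality survives the limit.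

For uniform integrability, let `g y = (|y| - K)⁺`. By convexity `g` lies below its chord over `[Td
x, Tu x]`; the chord's value at `x` is the mean of `g` under the kernel of `P`, and its slope is at
most 1 in absolute value. The slope at `B 0` is a bounded time-0 variable, hence orthogonal to `Z t
- B 0`. Thus `E[g (Z t)] ≤ ∫ g dν` for every `t`, which tends to 0 as `K → ∞`. Neither finiteness of
`τ_R` nor the law of the terminal value enters. -/

open Filter Topology

namespace LeftMonotone

/-! ### Telescoping of stopped increments along a grid -/

/-- The `k`-th point of the grid that divides `[s, t]` into `n` equal intervals. -/
noncomputable def gridPoint (s t : ℝ≥0) (n k : ℕ) : ℝ≥0 := s + k * ((t - s) / n)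

lemma gridPoint_zero (s t : ℝ≥0) (n : ℕ) : gridPoint s t n 0 = s := by simp [gridPoint]

lemma gridPoint_succ (s t : ℝ≥0) (n k : ℕ) :
    gridPoint s t n (k + 1) = gridPoint s t n k + (t - s) / n := by
  simp only [gridPoint]; push_cast; ring

lemma gridPoint_self {s t : ℝ≥0} (hst : s ≤ t) {n : ℕ} (hn : n ≠ 0) : gridPoint s t n n = t := by
  have : (n : ℝ≥0) ≠ 0 := by exact_mod_cast hn
  rw [gridPoint, mul_div_cancel₀ _ this, add_tsub_cancel_of_le hst]

lemma gridPoint_mono (s t : ℝ≥0) (n : ℕ) : Monotone (gridPoint s t n) :=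
  monotone_nat_of_le_succ fun k => by rw [gridPoint_succ]; exact le_self_add

/-- The sum telescopes until the grid reaches `σ` and is frozen afterwards, so `c` overshoots by at
most one mesh. The last clause is what lets the induction add the next increment. -/
lemma exists_sum_stopped_increments_eq (f : ℝ≥0 → ℝ) {s t σ : ℝ≥0} (hσ : s < σ) (n m : ℕ) :
    ∃ c, (∑ k ∈ Finset.range m, if gridPoint s t n k < σ then
        f (gridPoint s t n (k + 1)) - f (gridPoint s t n k) else 0) = f c - f s ∧
      min (gridPoint s t n m) σ ≤ c ∧ c ≤ min (gridPoint s t n m) σ + (t - s) / n ∧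
      (gridPoint s t n m < σ → c = gridPoint s t n m) := by
  induction m with
  | zero => exact ⟨s, by simp, by simp [gridPoint_zero], by simp [gridPoint_zero, hσ.le],
      by simp [gridPoint_zero]⟩
  | succ m ih =>
    obtain ⟨c, h1, h2, h3, h4⟩ := ih
    rw [Finset.sum_range_succ, h1]
    split_ifs with h
    · rw [h4 h]
      refine ⟨gridPoint s t n (m + 1), by ring, min_le_left _ _, ?_, fun _ => rfl⟩
      rw [← min_add_add_right]
      refine le_min le_self_add ?_
      rw [gridPoint_succ]
      gcongr
    · have h' : σ ≤ gridPoint s t n m := not_lt.1 h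
      have h'' : σ ≤ gridPoint s t n (m + 1) := h'.trans (gridPoint_mono s t n (Nat.le_succ m))
      rw [min_eq_right h'] at h2 h3
      rw [min_eq_right h'']
      exact ⟨c, by ring, h2, h3, fun h5 => absurd h5 (not_lt.2 h'')⟩

theorem tendsto_sum_stopped_increments {f : ℝ≥0 → ℝ} (hf : Continuous f) {s t σ : ℝ≥0}
    (hst : s ≤ t) (hσ : σ ≤ t) :
    Tendsto (fun n : ℕ => ∑ k ∈ Finset.range n, if gridPoint s t n k < σ then
        f (gridPoint s t n (k + 1)) - f (gridPoint s t n k) else 0) atTop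
      (𝓝 (f σ - f (min s σ))) := by
  rcases le_or_gt σ s with h | h
  · rw [min_eq_right h, sub_self]
    refine tendsto_const_nhds.congr fun n => ?_
    symm
    refine Finset.sum_eq_zero fun k _ => if_neg (not_lt.2 (h.trans ?_))
    exact le_self_add
  · rw [min_eq_left h.le]
    choose c h1 h2 h3 _ using fun n => exists_sum_stopped_increments_eq f (t := t) h n n
    have hc : Tendsto c atTop (𝓝 σ) := by
      have hlim : Tendsto (fun n : ℕ => σ + (t - s) / n) atTop (𝓝 σ) := by
        simpa using tendsto_const_nhds.add (tendsto_const_div_atTop_nhds_zero_nat (𝕜 := ℝ≥0) (t - s))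
      refine tendsto_of_tendsto_of_tendsto_of_le_of_le' tendsto_const_nhds hlim ?_ ?_
      · filter_upwards [eventually_ne_atTop 0] with n hn
        simpa [gridPoint_self hst hn, min_eq_right hσ] using h2 n
      · filter_upwards [eventually_ne_atTop 0] with n hn
        simpa [gridPoint_self hst hn, min_eq_right hσ] using h3 n
    simp_rw [h1]
    exact ((hf.tendsto σ).comp hc).sub tendsto_const_nhds

/-! ### Discrete stochastic integrals of Brownian increments -/

variable {Ω : Type*} {mΩ : MeasurableSpace Ω}

/-- An adapted process whose increments are independent of the past, centered, and of variance
equal to the elapsed time. -/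
structure HasBrownianIncrements (B : ℝ≥0 → Ω → ℝ) (𝓕 : Filtration ℝ≥0 mΩ) (Q : Measure Ω) :
    Prop where
  stronglyAdapted : StronglyAdapted 𝓕 B
  memLp : ∀ s t : ℝ≥0, s ≤ t → MemLp (fun ω => B t ω - B s ω) 2 Q
  integral_eq_zero : ∀ s t : ℝ≥0, s ≤ t → ∫ ω, (B t ω - B s ω) ∂Q = 0
  integral_sq : ∀ s t : ℝ≥0, s ≤ t → ∫ ω, (B t ω - B s ω) ^ 2 ∂Q = t - s
  indep : ∀ s t : ℝ≥0, s ≤ t →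
    Indep (MeasurableSpace.comap (fun ω => B t ω - B s ω) inferInstance) (𝓕 s) Q

lemma IsBrownianMotionFrom.hasBrownianIncrements {μ : Measure ℝ} {B : ℝ≥0 → Ω → ℝ}
    {𝓕 : Filtration ℝ≥0 mΩ} {Q : Measure Ω} (hB : IsBrownianMotionFrom μ B 𝓕 Q) :
    HasBrownianIncrements B 𝓕 Q := by
  have hlaw : ∀ s t : ℝ≥0, HasLaw (fun ω => B t ω - B s ω) (gaussianReal 0 (nndist t.1 s.1)) Q := by
    intro s t
    convert hB.isBrownian.hasLaw_sub t s using 1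
    ext ω
    simp
  refine ⟨hB.stronglyAdapted, fun s t _ => ?_, fun s t _ => ?_, fun s t hst => ?_, hB.indep⟩
  · have h := memLp_id_gaussianReal (μ := 0) (v := nndist t.1 s.1) 2
    rw [← (hlaw s t).map_eq] at h
    exact (memLp_map_measure_iff aestronglyMeasurable_id (hlaw s t).aemeasurable).1 h
  · rw [(hlaw s t).integral_eq, integral_id_gaussianReal]
  · have h1 : ∫ ω, (B t ω - B s ω) ^ 2 ∂Q = ∫ x, x ^ 2 ∂(gaussianReal 0 (nndist t.1 s.1)) :=
      (hlaw s t).integral_comp (f := fun x => x ^ 2) (by fun_prop)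
    have h2 := variance_id_gaussianReal (μ := 0) (v := nndist t.1 s.1)
    rw [variance_eq_integral (by fun_prop)] at h2
    simp only [id_eq, integral_id_gaussianReal, sub_zero] at h2
    rw [h1, h2, coe_nndist, Real.dist_eq, abs_of_nonneg (sub_nonneg.2 (by exact_mod_cast hst))]
    rfl

namespace HasBrownianIncrements

variable {B : ℝ≥0 → Ω → ℝ} {𝓕 : Filtration ℝ≥0 mΩ} {Q : Measure Ω}

/-- Independence factorizes the Bochner integral even when `Y` is not integrable, so measurability
of `Y` suffices. -/
lemma integral_mul_sub_eq_zero (hB : HasBrownianIncrements B 𝓕 Q) {s t : ℝ≥0} (hst : s ≤ t)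
    {Y : Ω → ℝ} (hY : Measurable[𝓕 s] Y) : ∫ ω, Y ω * (B t ω - B s ω) ∂Q = 0 := by
  have hind : IndepFun Y (fun ω => B t ω - B s ω) Q := by
    rw [IndepFun_iff_Indep]
    exact indep_of_indep_of_le_left (hB.indep s t hst).symm hY.comap_le
  rw [hind.integral_fun_mul_eq_mul_integral (hY.mono (𝓕.le s) le_rfl).aestronglyMeasurable
    (hB.memLp s t hst).aestronglyMeasurable, hB.integral_eq_zero s t hst, mul_zero]

/-- Each new increment is orthogonal to everything known at its left endpoint. Cross terms in the
square therefore vanish, and the variances add up to at most the elapsed time. -/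
lemma sum_indicator (hB : HasBrownianIncrements B 𝓕 Q) [IsProbabilityMeasure Q]
    {u : ℕ → ℝ≥0} (hu : Monotone u) {E : ℕ → Set Ω} (hE : ∀ k, MeasurableSet[𝓕 (u k)] (E k))
    {Y : Ω → ℝ} (hY : Measurable[𝓕 (u 0)] Y) (hY1 : ∀ ω, |Y ω| ≤ 1) (m : ℕ) :
    Measurable[𝓕 (u m)] (fun ω => ∑ k ∈ Finset.range m,
        (E k).indicator (fun ω => B (u (k + 1)) ω - B (u k) ω) ω) ∧
      MemLp (fun ω => ∑ k ∈ Finset.range m,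
        (E k).indicator (fun ω => B (u (k + 1)) ω - B (u k) ω) ω) 2 Q ∧
      ∫ ω, (∑ k ∈ Finset.range m,
        (E k).indicator (fun ω => B (u (k + 1)) ω - B (u k) ω) ω) ^ 2 ∂Q ≤ u m - u 0 ∧
      ∫ ω, Y ω * (∑ k ∈ Finset.range m,
        (E k).indicator (fun ω => B (u (k + 1)) ω - B (u k) ω) ω) ∂Q = 0 := by
  induction m with
  | zero => simp [measurable_const]
  | succ m ih =>
    obtain ⟨h1, h2, h3, h4⟩ := ih
    set S : Ω → ℝ := fun ω => ∑ k ∈ Finset.range m,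
        (E k).indicator (fun ω => B (u (k + 1)) ω - B (u k) ω) ω with hS
    set d : Ω → ℝ := fun ω => B (u (m + 1)) ω - B (u m) ω with hd
    have hle : u m ≤ u (m + 1) := hu (Nat.le_succ m)
    have hd2 : MemLp d 2 Q := hB.memLp _ _ hle
    have hEm : MeasurableSet (E m) := 𝓕.le _ _ (hE m)
    have hi2 : MemLp ((E m).indicator d) 2 Q := hd2.indicator hEm
    have hsum : ∀ ω, ∑ k ∈ Finset.range (m + 1),
        (E k).indicator (fun ω => B (u (k + 1)) ω - B (u k) ω) ω = S ω + (E m).indicator d ω := by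
      intro ω; rw [Finset.sum_range_succ]
    simp_rw [hsum]
    have hdm : Measurable[𝓕 (u (m + 1))] d :=
      (hB.stronglyAdapted _).measurable.sub
        ((hB.stronglyAdapted _).measurable.mono (𝓕.mono hle) le_rfl)
    have hYb : Measurable Y := hY.mono (𝓕.le _) le_rfl
    have hYm : Measurable[𝓕 (u m)] Y := hY.mono (𝓕.mono (hu (Nat.zero_le m))) le_rfl
    have hone : Measurable[𝓕 (u m)] ((E m).indicator (fun _ => (1 : ℝ))) :=
      measurable_const.indicator (hE m)
    have hind : ∀ ω, (E m).indicator d ω = (E m).indicator (fun _ => (1 : ℝ)) ω * d ω := by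
      intro ω
      by_cases h : ω ∈ E m <;> simp [h]
    refine ⟨?_, h2.add hi2, ?_, ?_⟩
    · exact (h1.mono (𝓕.mono hle) le_rfl).add (hdm.indicator (𝓕.mono hle _ (hE m)))
    · have hcross : ∫ ω, S ω * (E m).indicator d ω ∂Q = 0 := by
        simp_rw [hind, ← mul_assoc]
        exact hB.integral_mul_sub_eq_zero hle (h1.mul hone)
      have hsq : ∫ ω, (E m).indicator d ω ^ 2 ∂Q ≤ u (m + 1) - u m := by
        rw [← hB.integral_sq _ _ hle]
        refine integral_mono hi2.integrable_sq hd2.integrable_sq fun ω => ?_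
        by_cases h : ω ∈ E m <;> simp [h, hd]
        positivity
      have hexp : ∀ ω, (S ω + (E m).indicator d ω) ^ 2
          = S ω ^ 2 + (2 * (S ω * (E m).indicator d ω) + (E m).indicator d ω ^ 2) := by
        intro ω; ring
      simp_rw [hexp]
      have hint : Integrable (fun ω => S ω * (E m).indicator d ω) Q := h2.integrable_mul hi2
      have hint' : Integrable
          (fun ω => 2 * (S ω * (E m).indicator d ω) + (E m).indicator d ω ^ 2) Q :=
        (hint.const_mul 2).add hi2.integrable_sq
      rw [integral_add h2.integrable_sq hint', integral_add (hint.const_mul 2) hi2.integrable_sq, integral_const_mul, hcross]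
      linarith
    · have hbdd : ∀ Z : Ω → ℝ, MemLp Z 2 Q → Integrable (fun ω => Y ω * Z ω) Q := fun Z hZ =>
        (hZ.integrable (by norm_num)).bdd_mul hYb.aestronglyMeasurable
          (Eventually.of_forall fun ω => hY1 ω)
      simp_rw [mul_add]
      rw [integral_add (hbdd _ h2) (hbdd _ hi2), h4, zero_add]
      simp_rw [hind, ← mul_assoc]
      exact hB.integral_mul_sub_eq_zero hle (hYm.mul hone)

end HasBrownianIncrements

/-! ### Passing to the limit under an L² bound -/

/-- Convergence of integrals along an `L²`-bounded sequence converging almost everywhere. -/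
theorem integrable_and_integral_mul_eq_zero_of_tendsto {Q : Measure Ω} [IsProbabilityMeasure Q]
    {S : ℕ → Ω → ℝ} {X : Ω → ℝ} (hS : ∀ n, MemLp (S n) 2 Q) {M : ℝ}
    (hM : ∀ n, ∫ ω, S n ω ^ 2 ∂Q ≤ M)
    (hlim : ∀ᵐ ω ∂Q, Tendsto (fun n => S n ω) atTop (𝓝 (X ω)))
    {Y : Ω → ℝ} (hY : Measurable Y) (hY1 : ∀ ω, |Y ω| ≤ 1)
    (hYS : ∀ n, ∫ ω, Y ω * S n ω ∂Q = 0) :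
    Integrable X Q ∧ ∫ ω, Y ω * X ω ∂Q = 0 := by
  have hSi : ∀ n, Integrable (S n) Q := fun n => (hS n).integrable (by norm_num)
  have hX : Integrable X Q := by
    refine ⟨aestronglyMeasurable_of_tendsto_ae _ (fun n => (hS n).aestronglyMeasurable) hlim, ?_⟩
    have h1 : ∫⁻ ω, ‖X ω‖ₑ ∂Q ≤ liminf (fun n => ∫⁻ ω, ‖S n ω‖ₑ ∂Q) atTop := by
      rw [lintegral_congr_ae (g := fun ω => liminf (fun n => ‖S n ω‖ₑ) atTop)
        (by filter_upwards [hlim] with ω h using h.enorm.liminf_eq.symm)]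
      exact lintegral_liminf_le' fun n => (hS n).aestronglyMeasurable.enorm
    have h2 : ∀ n, ∫⁻ ω, ‖S n ω‖ₑ ∂Q ≤ ENNReal.ofReal (1 + M) := by
      intro n
      rw [← ofReal_integral_norm_eq_lintegral_enorm (hSi n)]
      refine ENNReal.ofReal_le_ofReal ?_
      calc ∫ ω, ‖S n ω‖ ∂Q ≤ ∫ ω, (1 + S n ω ^ 2) ∂Q := by
            refine integral_mono (hSi n).norm ((integrable_const 1).add (hS n).integrable_sq) ?_
            intro ω
            have := sq_nonneg (|S n ω| - 1)
            have h := sq_abs (S n ω)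
            simp only [Real.norm_eq_abs]
            nlinarith [abs_nonneg (S n ω)]
        _ ≤ 1 + M := by
            rw [integral_add (integrable_const 1) (hS n).integrable_sq]
            simpa using hM n
    refine (h1.trans (liminf_le_of_le ?_ ?_)).trans_lt (ENNReal.ofReal_lt_top (r := 1 + M))
    · isBoundedDefault
    · intro b hb
      obtain ⟨n, hn⟩ := hb.exists
      exact hn.trans (h2 n)
  refine ⟨hX, ?_⟩
  -- Truncate at level `K`: since `K * |c K y - y| ≤ y ^ 2`, the truncated integrals are at most `M
  -- / K` uniformly in `n`. Dominated convergence gives first `n → ∞` at fixed `K`, then `K → ∞`.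
  let c : ℕ → ℝ → ℝ := fun K y => max (-(K : ℝ)) (min y K)
  have hc_meas : ∀ K, Continuous (c K) := fun K => by fun_prop
  have hc_abs : ∀ K y, |c K y| ≤ K := fun K y => by
    have : (0 : ℝ) ≤ K := K.cast_nonneg
    rw [abs_le]
    exact ⟨le_max_left _ _, max_le (by linarith) (min_le_right _ _)⟩
  have hc_le : ∀ K y, |c K y| ≤ |y| := fun K y => by
    have hK : (0 : ℝ) ≤ K := K.cast_nonneg
    rw [abs_le]
    constructor
    · refine le_max_of_le_right (le_min (neg_abs_le y) ?_)
      linarith [abs_nonneg y]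
    · exact max_le (by linarith [abs_nonneg y]) ((min_le_left _ _).trans (le_abs_self y))
  have hc_sub : ∀ (K : ℕ) (y : ℝ), (K : ℝ) * |c K y - y| ≤ y ^ 2 := fun K y => by
    have hK : (0 : ℝ) ≤ K := K.cast_nonneg
    rcases le_total y K with h1 | h1
    · rcases le_total (-(K : ℝ)) y with h2 | h2
      · simp [c, min_eq_left h1, max_eq_right h2]; positivity
      · simp only [c, min_eq_left h1, max_eq_left h2]
        rw [abs_of_nonneg (by linarith)]
        nlinarith
    · have : c K y = K := by
        simp only [c, min_eq_right h1]; exact max_eq_right (by linarith)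
      rw [this, abs_of_nonpos (by linarith)]
      nlinarith
  have hYc : ∀ K : ℕ, ∀ Z : Ω → ℝ, AEStronglyMeasurable Z Q →
      Integrable (fun ω => Y ω * c K (Z ω)) Q := fun K Z hZ => by
    refine Integrable.of_bound (C := K) (hY.aestronglyMeasurable.mul
      ((hc_meas K).comp_aestronglyMeasurable hZ)) (Eventually.of_forall fun ω => ?_)
    rw [norm_mul]
    calc |Y ω| * |c K (Z ω)| ≤ 1 * K :=
          mul_le_mul (hY1 ω) (hc_abs K _) (abs_nonneg _) zero_le_one
      _ = K := one_mul _
  have hYi : ∀ Z : Ω → ℝ, Integrable Z Q → Integrable (fun ω => Y ω * Z ω) Q := fun Z hZ =>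
    hZ.bdd_mul hY.aestronglyMeasurable (Eventually.of_forall fun ω => hY1 ω)
  have hbound : ∀ K : ℕ, ∀ n, (K : ℝ) * |∫ ω, Y ω * c K (S n ω) ∂Q| ≤ M := by
    intro K n
    have hK : (0 : ℝ) ≤ K := K.cast_nonneg
    have : ∫ ω, Y ω * c K (S n ω) ∂Q = ∫ ω, Y ω * (c K (S n ω) - S n ω) ∂Q := by
      simp_rw [mul_sub]
      rw [integral_sub (hYc K _ (hS n).aestronglyMeasurable) (hYi _ (hSi n)), hYS, sub_zero]
    rw [this, ← abs_of_nonneg hK, ← abs_mul, ← integral_const_mul]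
    refine (abs_integral_le_integral_abs).trans (le_trans ?_ (hM n))
    refine integral_mono_of_nonneg (Eventually.of_forall fun ω => abs_nonneg _)
      (hS n).integrable_sq (Eventually.of_forall fun ω => ?_)
    simp only [abs_mul, abs_of_nonneg hK]
    calc (K : ℝ) * (|Y ω| * |c K (S n ω) - S n ω|) ≤ K * (1 * |c K (S n ω) - S n ω|) := by
          gcongr; exact hY1 ω
      _ ≤ S n ω ^ 2 := by rw [one_mul]; exact hc_sub K _
  have hboundX : ∀ K : ℕ, (K : ℝ) * |∫ ω, Y ω * c K (X ω) ∂Q| ≤ M := by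
    intro K
    have ht : Tendsto (fun n => ∫ ω, Y ω * c K (S n ω) ∂Q) atTop
        (𝓝 (∫ ω, Y ω * c K (X ω) ∂Q)) := by
      refine tendsto_integral_of_dominated_convergence (fun _ => (K : ℝ))
        (fun n => (hYc K _ (hS n).aestronglyMeasurable).aestronglyMeasurable)
        (integrable_const _) (fun n => Eventually.of_forall fun ω => ?_) ?_
      · rw [norm_mul]
        calc |Y ω| * |c K (S n ω)| ≤ 1 * K :=
              mul_le_mul (hY1 ω) (hc_abs K _) (abs_nonneg _) zero_le_one
          _ = K := one_mul _
      · filter_upwards [hlim] with ω h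
        exact (((hc_meas K).tendsto _).comp h).const_mul _
    exact le_of_tendsto (ht.abs.const_mul _) (Eventually.of_forall (hbound K))
  have hlimK : Tendsto (fun K : ℕ => ∫ ω, Y ω * c K (X ω) ∂Q) atTop (𝓝 (∫ ω, Y ω * X ω ∂Q)) := by
    refine tendsto_integral_of_dominated_convergence (fun ω => ‖X ω‖)
      (fun K => (hYc K _ hX.aestronglyMeasurable).aestronglyMeasurable)
      hX.norm (fun K => Eventually.of_forall fun ω => ?_) (Eventually.of_forall fun ω => ?_)
    · rw [norm_mul]
      calc |Y ω| * |c K (X ω)| ≤ 1 * |X ω| :=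
            mul_le_mul (hY1 ω) (hc_le K _) (abs_nonneg _) zero_le_one
        _ = ‖X ω‖ := one_mul _
    · refine Tendsto.const_mul _ (tendsto_const_nhds.congr' ?_)
      obtain ⟨N, hN⟩ := exists_nat_ge |X ω|
      filter_upwards [eventually_ge_atTop N] with K hK
      have h' : |X ω| ≤ K := hN.trans (by exact_mod_cast hK)
      rw [abs_le] at h'
      simp [c, min_eq_left h'.2, max_eq_right h'.1]
  have hzero : Tendsto (fun K : ℕ => ∫ ω, Y ω * c K (X ω) ∂Q) atTop (𝓝 0) := by
    refine squeeze_zero_norm' ?_ (tendsto_const_div_atTop_nhds_zero_nat M)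
    filter_upwards [eventually_gt_atTop 0] with K hK
    rw [le_div_iff₀ (by exact_mod_cast hK), mul_comm]
    exact hboundX K
  exact tendsto_nhds_unique hlimK hzero


/-! ### Martingale property of the stopped process -/

lemma lt_untopA_min_iff {ι : Type*} [LinearOrder ι] [Nonempty ι] {r t : ι} {τ : WithTop ι} :
    r < (min (t : WithTop ι) τ).untopA ↔ r < t ∧ (r : WithTop ι) < τ := by
  induction τ with
  | top => simp
  | coe a =>
    rw [← WithTop.coe_min, WithTop.coe_lt_coe, ← lt_min_iff]
    rfl

lemma untopA_min_le {ι : Type*} [LinearOrder ι] [Nonempty ι] {t : ι} {τ : WithTop ι} :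
    (min (t : WithTop ι) τ).untopA ≤ t :=
  le_of_not_gt fun h => lt_irrefl _ (lt_untopA_min_iff.1 h).1

lemma min_untopA_min {ι : Type*} [LinearOrder ι] [Nonempty ι] {s t : ι} (hst : s ≤ t)
    (τ : WithTop ι) :
    min s (min (t : WithTop ι) τ).untopA = (min (s : WithTop ι) τ).untopA := by
  refine eq_of_forall_lt_iff fun r => ?_
  rw [lt_min_iff, lt_untopA_min_iff, lt_untopA_min_iff]
  exact ⟨fun h => ⟨h.1, h.2.2⟩, fun h => ⟨h.1, h.1.trans_le hst, h.2⟩⟩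

lemma stoppedProcess_zero (B : ℝ≥0 → Ω → ℝ) (τ : Ω → WithTop ℝ≥0) :
    stoppedProcess B τ 0 = B 0 := by
  ext ω
  exact stoppedProcess_eq_of_le (by simp)

theorem tendsto_sum_indicator_stoppedProcess {B : ℝ≥0 → Ω → ℝ} (τ : Ω → WithTop ℝ≥0)
    {s t : ℝ≥0} (hst : s ≤ t) {ω : Ω} (hω : Continuous fun t => B t ω) :
    Tendsto (fun n : ℕ => ∑ k ∈ Finset.range n,
        {ω | (gridPoint s t n k : WithTop ℝ≥0) < τ ω}.indicator
          (fun ω => B (gridPoint s t n (k + 1)) ω - B (gridPoint s t n k) ω) ω) atTop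
      (𝓝 (stoppedProcess B τ t ω - stoppedProcess B τ s ω)) := by
  have h := tendsto_sum_stopped_increments hω hst
    (untopA_min_le (t := t) (τ := τ ω))
  rw [min_untopA_min hst] at h
  refine h.congr fun n => Finset.sum_congr rfl fun k hk => ?_
  have hkn : k + 1 ≤ n := Finset.mem_range.1 hk
  simp only [Set.indicator_apply, Set.mem_ofPred_eq]
  by_cases hlt : gridPoint s t n k < t
  · exact if_congr (lt_untopA_min_iff.trans (and_iff_right hlt)) rfl rfl
  -- A grid point before the last one reaches `t` only if the mesh is zero, and then the increment
  -- vanishes.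
  · have h1 : gridPoint s t n (k + 1) ≤ t :=
      (gridPoint_mono s t n hkn).trans_eq (gridPoint_self hst (by omega))
    have h2 : gridPoint s t n (k + 1) = gridPoint s t n k :=
      le_antisymm (h1.trans (not_lt.1 hlt)) (gridPoint_mono s t n (Nat.le_succ k))
    rw [h2, sub_self, ite_self, ite_self]

theorem HasBrownianIncrements.integral_mul_stoppedProcess_sub {B : ℝ≥0 → Ω → ℝ}
    {𝓕 : Filtration ℝ≥0 mΩ} {Q : Measure Ω} [IsProbabilityMeasure Q]
    (hB : HasBrownianIncrements B 𝓕 Q) {τ : Ω → WithTop ℝ≥0}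
    (hτ : ∀ r : ℝ≥0, MeasurableSet[𝓕 r] {ω | (r : WithTop ℝ≥0) < τ ω})
    (hcont : ∀ᵐ ω ∂Q, Continuous fun t => B t ω) {s t : ℝ≥0} (hst : s ≤ t)
    {Y : Ω → ℝ} (hY : Measurable[𝓕 s] Y) (hY1 : ∀ ω, |Y ω| ≤ 1) :
    Integrable (fun ω => stoppedProcess B τ t ω - stoppedProcess B τ s ω) Q ∧
      ∫ ω, Y ω * (stoppedProcess B τ t ω - stoppedProcess B τ s ω) ∂Q = 0 := by
  have key := fun n : ℕ => hB.sum_indicator (gridPoint_mono s t n) (fun k => hτ (gridPoint s t n k))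
    (by rwa [gridPoint_zero]) hY1 n
  refine integrable_and_integral_mul_eq_zero_of_tendsto (M := t - s) (fun n => (key n).2.1)
    (fun n => (key n).2.2.1.trans ?_) ?_ (hY.mono (𝓕.le s) le_rfl) hY1 (fun n => (key n).2.2.2)
  · rw [gridPoint_zero]
    rcases eq_or_ne n 0 with rfl | hn
    · simpa [gridPoint_zero] using hst
    · rw [gridPoint_self hst hn]
  · filter_upwards [hcont] with ω hω using tendsto_sum_indicator_stoppedProcess τ hst hω

/-- On continuous paths the stopped value is a limit of adapted grid sums; off them every set is
already in `𝓕 0`. No right-continuity of the filtration is needed. -/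
theorem HasBrownianIncrements.measurable_stoppedProcess {B : ℝ≥0 → Ω → ℝ}
    {𝓕 : Filtration ℝ≥0 mΩ} {Q : Measure Ω} [IsProbabilityMeasure Q]
    (hB : HasBrownianIncrements B 𝓕 Q) {τ : Ω → WithTop ℝ≥0}
    (hτ : ∀ r : ℝ≥0, MeasurableSet[𝓕 r] {ω | (r : WithTop ℝ≥0) < τ ω})
    (h𝓕 : ∀ A : Set Ω, A ⊆ {ω | ¬ Continuous fun t => B t ω} → MeasurableSet[𝓕 0] A) (t : ℝ≥0) :
    Measurable[𝓕 t] (stoppedProcess B τ t) := by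
  set C : Set Ω := {ω | Continuous fun t => B t ω} with hC
  have hCm : MeasurableSet[𝓕 t] C := by
    have := 𝓕.mono (zero_le (a := t)) _ (h𝓕 Cᶜ subset_rfl)
    exact (@MeasurableSet.compl_iff _ _ (𝓕 t)).1 this
  have key := fun n : ℕ => (hB.sum_indicator (gridPoint_mono 0 t n)
    (fun k => hτ (gridPoint 0 t n k)) (Y := fun _ => 0) measurable_const (by simp) n).1
  have key' : ∀ n : ℕ, Measurable[𝓕 t] (fun ω => ∑ k ∈ Finset.range n,
        {ω | (gridPoint 0 t n k : WithTop ℝ≥0) < τ ω}.indicator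
          (fun ω => B (gridPoint 0 t n (k + 1)) ω - B (gridPoint 0 t n k) ω) ω) := by
    intro n
    rcases eq_or_ne n 0 with rfl | hn
    · simp [measurable_const]
    · have := key n
      rwa [gridPoint_self zero_le hn] at this
  have hB0 : Measurable[𝓕 t] (B 0) :=
    (hB.stronglyAdapted 0).measurable.mono (𝓕.mono zero_le) le_rfl
  have hlim : Measurable[𝓕 t] (C.indicator (stoppedProcess B τ t)) := by
    refine @measurable_of_tendsto_metrizable _ _ (𝓕 t) _ _ _ _
      (fun n : ℕ => C.indicator fun ω => B 0 ω + ∑ k ∈ Finset.range n,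
        {ω | (gridPoint 0 t n k : WithTop ℝ≥0) < τ ω}.indicator
          (fun ω => B (gridPoint 0 t n (k + 1)) ω - B (gridPoint 0 t n k) ω) ω) _
      (fun n => (hB0.add (key' n)).indicator hCm) ?_
    rw [tendsto_pi_nhds]
    intro ω
    by_cases hω : ω ∈ C
    · simp only [Set.indicator_of_mem hω]
      have := (tendsto_sum_indicator_stoppedProcess τ (zero_le (a := t)) hω).const_add (B 0 ω)
      simpa [stoppedProcess_zero] using this
    · simp only [Set.indicator_of_notMem hω]
      exact tendsto_const_nhds
  intro S hS
  have hS' : stoppedProcess B τ t ⁻¹' S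
      = (C ∩ C.indicator (stoppedProcess B τ t) ⁻¹' S) ∪ (Cᶜ ∩ stoppedProcess B τ t ⁻¹' S) := by
    ext ω
    by_cases hω : ω ∈ C <;> simp [hω]
  rw [hS']
  exact @MeasurableSet.union _ (𝓕 t) _ _ (@MeasurableSet.inter _ (𝓕 t) _ _ hCm (hlim hS))
    (𝓕.mono zero_le _ (h𝓕 _ Set.inter_subset_left))

/-- Testing against indicators of sets in `𝓕 s` characterizes the conditional expectation. Only the
increments are controlled through L²; `B 0` is merely integrable. -/
theorem HasBrownianIncrements.martingale_stoppedProcess {B : ℝ≥0 → Ω → ℝ}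
    {𝓕 : Filtration ℝ≥0 mΩ} {Q : Measure Ω} [IsProbabilityMeasure Q]
    (hB : HasBrownianIncrements B 𝓕 Q) (h0 : Integrable (B 0) Q) {τ : Ω → WithTop ℝ≥0}
    (hτ : ∀ r : ℝ≥0, MeasurableSet[𝓕 r] {ω | (r : WithTop ℝ≥0) < τ ω})
    (hcont : ∀ᵐ ω ∂Q, Continuous fun t => B t ω)
    (h𝓕 : ∀ A : Set Ω, A ⊆ {ω | ¬ Continuous fun t => B t ω} → MeasurableSet[𝓕 0] A) :
    Martingale (stoppedProcess B τ) 𝓕 Q := by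
  have hmeas := hB.measurable_stoppedProcess hτ h𝓕
  have hint : ∀ t, Integrable (stoppedProcess B τ t) Q := by
    intro t
    have := (hB.integral_mul_stoppedProcess_sub hτ hcont (zero_le (a := t)) (Y := fun _ => 0)
      measurable_const (by simp)).1.add h0
    simpa [stoppedProcess_zero, Pi.add_def] using this
  refine ⟨fun t => (hmeas t).stronglyMeasurable, fun s t hst => ?_⟩
  refine (ae_eq_condExp_of_forall_setIntegral_eq (𝓕.le s) (hint t)
    (fun A _ _ => (hint s).integrableOn) (fun A hA _ => ?_)
    (hmeas s).stronglyMeasurable.aestronglyMeasurable).symm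
  have h := (hB.integral_mul_stoppedProcess_sub hτ hcont hst (Y := A.indicator fun _ => 1)
    (measurable_const.indicator hA) (fun ω => by by_cases h : ω ∈ A <;> simp [h])).2
  have hA' : MeasurableSet A := 𝓕.le s _ hA
  have h' : ∀ ω, A.indicator (fun _ => (1 : ℝ)) ω
        * (stoppedProcess B τ t ω - stoppedProcess B τ s ω)
      = A.indicator (fun ω => stoppedProcess B τ t ω - stoppedProcess B τ s ω) ω := by
    intro ω
    by_cases h : ω ∈ A <;> simp [h]
  simp_rw [h'] at h
  rw [integral_indicator hA', integral_sub (hint t).integrableOn (hint s).integrableOn] at h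
  linarith

/-! ### The barrier time as an exit time -/

lemma mem_halfBarrier {D : Set ℝ} {T : ℝ → ℝ} {x y : ℝ} :
    (y - x, y) ∈ halfBarrier D T ↔ ∃ z ∈ D, x ≤ z ∧ y = T z := by
  simp only [halfBarrier, Set.mem_iUnion, Set.mem_prod, Set.mem_Ici, Set.mem_singleton_iff,
    exists_prop]
  refine exists_congr fun z => and_congr_right fun _ => ?_
  constructor
  · rintro ⟨h1, rfl⟩
    exact ⟨by linarith, rfl⟩
  · rintro ⟨h1, rfl⟩
    exact ⟨by linarith, rfl⟩

section Barrier

variable {μ : Measure ℝ} {P : Measure (ℝ × ℝ)} {D : Set ℝ} {Td Tu : ℝ → ℝ}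

lemma IsTransportPair.notMem_barrier (hT : IsTransportPair μ P D Td Tu) {x y : ℝ} (hx : x ∈ D)
    (hy : y ∈ Set.Ioo (Td x) (Tu x)) : (y - x, y) ∉ barrier D Td Tu := by
  rintro (h | h) <;> obtain ⟨z, hz, hxz, rfl⟩ := mem_halfBarrier.1 h
  · exact absurd (hT.up_mono x hx z hz hxz) (not_le.2 hy.2)
  · rcases hxz.eq_or_lt with rfl | hxz
    · exact lt_irrefl _ hy.1
    · exact hT.down_notMem x hx z hz hxz hy

/-- A path leaving the interval must hit an endpoint, which lies in the barrier. Conversely the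
interval is open, so a path inside up to `r` stays inside slightly longer, making the infimum
strictly larger than `r`. -/
lemma IsTransportPair.lt_barrierTime_iff (hT : IsTransportPair μ P D Td Tu) {B : ℝ≥0 → Ω → ℝ}
    {ω : Ω} (hω : Continuous fun t => B t ω) (h0 : B 0 ω ∈ D) {r : ℝ≥0} :
    (r : WithTop ℝ≥0) < barrierTime B (barrier D Td Tu) ω ↔
      ∀ u ≤ r, B u ω ∈ Set.Ioo (Td (B 0 ω)) (Tu (B 0 ω)) := by
  constructor
  · intro hr u hu
    have hno : ∀ v ≤ r, (B v ω - B 0 ω, B v ω) ∉ barrier D Td Tu := fun v hv =>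
      notMem_of_lt_hittingAfter (u := fun t ω => (B t ω - B 0 ω, B t ω))
        (lt_of_le_of_lt (WithTop.coe_le_coe.2 hv) hr) zero_le
    constructor
    · by_contra! h
      obtain ⟨v, hv, hBv⟩ := intermediate_value_Icc' zero_le hω.continuousOn
        (show Td (B 0 ω) ∈ Set.Icc (B u ω) (B 0 ω) from ⟨h, hT.down_le _ h0⟩)
      exact hno v (hv.2.trans hu) (Or.inr (mem_halfBarrier.2 ⟨_, h0, le_rfl, hBv⟩))
    · by_contra! h
      obtain ⟨v, hv, hBv⟩ := intermediate_value_Icc zero_le hω.continuousOn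
        (show Tu (B 0 ω) ∈ Set.Icc (B 0 ω) (B u ω) from ⟨hT.le_up _ h0, h⟩)
      exact hno v (hv.2.trans hu) (Or.inl (mem_halfBarrier.2 ⟨_, h0, le_rfl, hBv⟩))
  · intro h
    have hev : ∀ᶠ v in 𝓝 r, B v ω ∈ Set.Ioo (Td (B 0 ω)) (Tu (B 0 ω)) :=
      hω.continuousAt.eventually_mem (Ioo_mem_nhds (h r le_rfl).1 (h r le_rfl).2)
    obtain ⟨b, hb, hIco⟩ := exists_Ico_subset_of_mem_nhds hev ⟨r + 1, by simp⟩
    have hno : ∀ v < b, (B v ω - B 0 ω, B v ω) ∉ barrier D Td Tu := fun v hv =>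
      hT.notMem_barrier h0 (by
        rcases le_total v r with hvr | hvr
        · exact h v hvr
        · exact hIco ⟨hvr, hv⟩)
    refine lt_of_lt_of_le (WithTop.coe_lt_coe.2 hb) ?_
    rw [barrierTime, hittingAfter]
    split_ifs with hex
    · refine WithTop.coe_le_coe.2 (le_csInf hex fun v hv => ?_)
      exact le_of_not_gt fun hlt => hno v hlt hv.2
    · exact le_top

lemma IsTransportPair.stoppedProcess_mem_Icc (hT : IsTransportPair μ P D Td Tu)
    {B : ℝ≥0 → Ω → ℝ} {ω : Ω} (hω : Continuous fun t => B t ω) (h0 : B 0 ω ∈ D) (t : ℝ≥0) :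
    stoppedProcess B (barrierTime B (barrier D Td Tu)) t ω ∈
      Set.Icc (Td (B 0 ω)) (Tu (B 0 ω)) := by
  set c : ℝ≥0 := (min (t : WithTop ℝ≥0) (barrierTime B (barrier D Td Tu) ω)).untopA with hc
  change B c ω ∈ _
  rcases eq_or_ne c 0 with h | h
  · rw [h]
    exact ⟨hT.down_le _ h0, hT.le_up _ h0⟩
  · have hsub : Set.Iio c ⊆ (fun u => B u ω) ⁻¹' Set.Icc (Td (B 0 ω)) (Tu (B 0 ω)) := fun u hu =>
      Set.Ioo_subset_Icc_self
        ((hT.lt_barrierTime_iff hω h0).1 (lt_untopA_min_iff.1 hu).2 u le_rfl)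
    have hcl : c ∈ closure (Set.Iio c) := by
      rw [closure_Iio' ⟨0, pos_iff_ne_zero.2 h⟩]
      exact Set.mem_Iic.2 le_rfl
    exact closure_minimal hsub (isClosed_Icc.preimage hω) hcl

/-- By compactness of `[0, r]`, a continuous path inside the open interval keeps a margin `1 / (m +
1)`, and a closed condition with margin need only be checked at countably many times. -/
lemma IsTransportPair.measurableSet_lt_barrierTime (hT : IsTransportPair μ P D Td Tu)
    {B : ℝ≥0 → Ω → ℝ} {𝓕 : Filtration ℝ≥0 mΩ} (hB : StronglyAdapted 𝓕 B)
    (h𝓕 : ∀ A : Set Ω, A ⊆ {ω | ¬ (Continuous (fun t => B t ω) ∧ B 0 ω ∈ D)} →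
      MeasurableSet[𝓕 0] A) (r : ℝ≥0) :
    MeasurableSet[𝓕 r] {ω | (r : WithTop ℝ≥0) < barrierTime B (barrier D Td Tu) ω} := by
  set G : Set Ω := {ω | Continuous (fun t => B t ω) ∧ B 0 ω ∈ D} with hG
  have hGm : MeasurableSet[𝓕 r] G :=
    (@MeasurableSet.compl_iff _ _ (𝓕 r)).1 (𝓕.mono zero_le _ (h𝓕 Gᶜ subset_rfl))
  obtain ⟨S, hSc, hSd⟩ := TopologicalSpace.exists_countable_dense ℝ≥0
  have hBm : ∀ u ≤ r, Measurable[𝓕 r] (B u) := fun u hu =>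
    (hB u).measurable.mono (𝓕.mono hu) le_rfl
  have hTd : Measurable[𝓕 r] fun ω => Td (B 0 ω) := hT.measurable_down.comp (hBm 0 zero_le)
  have hTu : Measurable[𝓕 r] fun ω => Tu (B 0 ω) := hT.measurable_up.comp (hBm 0 zero_le)
  -- Times are capped by `min u r` so that a dense set of the whole half-line can be used without
  -- looking past `r`.
  set E : Set Ω := ⋃ m : ℕ, ⋂ u ∈ S, ({ω | Td (B 0 ω) + 1 / (m + 1) ≤ B (min u r) ω} ∩
    {ω | B (min u r) ω ≤ Tu (B 0 ω) - 1 / (m + 1)}) with hE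
  have hEm : MeasurableSet[𝓕 r] E := by
    refine @MeasurableSet.iUnion _ _ (𝓕 r) _ _ fun m =>
      @MeasurableSet.biInter _ _ (𝓕 r) _ _ hSc fun u _ => @MeasurableSet.inter _ (𝓕 r) _ _ ?_ ?_
    · exact @measurableSet_le _ _ _ _ _ (𝓕 r) _ _ _ _ _ (hTd.add_const _) (hBm _ (min_le_right _ _))
    · exact @measurableSet_le _ _ _ _ _ (𝓕 r) _ _ _ _ _ (hBm _ (min_le_right _ _)) (hTu.sub_const _)
  have hiff : ∀ ω ∈ G, ((r : WithTop ℝ≥0) < barrierTime B (barrier D Td Tu) ω ↔ ω ∈ E) := by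
    rintro ω ⟨hω, h0⟩
    rw [hT.lt_barrierTime_iff hω h0]
    simp only [hE, Set.mem_iUnion, Set.mem_iInter, Set.mem_inter_iff, Set.mem_ofPred_eq]
    constructor
    · intro h
      obtain ⟨v, hv, hvmin⟩ := isCompact_Icc.exists_isMinOn (Set.nonempty_Icc.2 zero_le)
        hω.continuousOn
      obtain ⟨w, hw, hwmax⟩ := isCompact_Icc.exists_isMaxOn (Set.nonempty_Icc.2 zero_le)
        hω.continuousOn
      obtain ⟨m, hm⟩ := exists_nat_one_div_lt
        (lt_min (sub_pos.2 (h v hv.2).1) (sub_pos.2 (h w hw.2).2))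
      rw [lt_min_iff] at hm
      refine ⟨m, fun u _ => ?_⟩
      have hu : min u r ∈ Set.Icc 0 r := ⟨zero_le, min_le_right _ _⟩
      have h1 : B v ω ≤ B (min u r) ω := hvmin hu
      have h2 : B (min u r) ω ≤ B w ω := hwmax hu
      constructor <;> linarith [hm.1, hm.2]
    · rintro ⟨m, hm⟩ u hu
      have hpos : (0 : ℝ) < 1 / (m + 1) := by positivity
      have hcl : IsClosed ((fun u => B (min u r) ω) ⁻¹'
          Set.Icc (Td (B 0 ω) + 1 / (m + 1)) (Tu (B 0 ω) - 1 / (m + 1))) :=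
        isClosed_Icc.preimage (hω.comp (continuous_id.min continuous_const))
      have hsub : S ⊆ (fun u => B (min u r) ω) ⁻¹'
          Set.Icc (Td (B 0 ω) + 1 / (m + 1)) (Tu (B 0 ω) - 1 / (m + 1)) := fun u hu => hm u hu
      have := closure_minimal hsub hcl (hSd u)
      rw [Set.mem_preimage, min_eq_left hu] at this
      constructor <;> linarith [this.1, this.2]
  have hset : {ω | (r : WithTop ℝ≥0) < barrierTime B (barrier D Td Tu) ω}
      = (G ∩ E) ∪ (Gᶜ ∩ {ω | (r : WithTop ℝ≥0) < barrierTime B (barrier D Td Tu) ω}) := by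
    ext ω
    by_cases hω : ω ∈ G
    · simpa only [Set.mem_union, Set.mem_inter_iff, Set.mem_compl_iff, Set.mem_ofPred_eq, hω, true_and,
        not_true_eq_false, false_and, or_false] using hiff ω hω
    · simp only [Set.mem_union, Set.mem_inter_iff, Set.mem_compl_iff, hω, not_false_eq_true,
        false_and, true_and, false_or]
  rw [hset]
  exact @MeasurableSet.union _ (𝓕 r) _ _ (@MeasurableSet.inter _ (𝓕 r) _ _ hGm hEm)
    (𝓕.mono zero_le _ (h𝓕 _ Set.inter_subset_left))

end Barrier


/-! ### Chords and the two-point kernel -/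

/-- The mean of `g` under the kernel `q(x) δ_{T_u(x)} + (1 - q(x)) δ_{T_d(x)}`. -/
noncomputable def kernelMean (Td Tu g : ℝ → ℝ) (x : ℝ) : ℝ :=
  upWeight Td Tu x * g (Tu x) + (1 - upWeight Td Tu x) * g (Td x)

lemma measurable_upWeight {Td Tu : ℝ → ℝ} (hd : Measurable Td) (hu : Measurable Tu) :
    Measurable (upWeight Td Tu) := by
  unfold upWeight
  exact Measurable.ite (measurableSet_lt hd hu)
    ((measurable_id.sub hd).div (hu.sub hd)) measurable_const

lemma measurable_kernelMean {Td Tu g : ℝ → ℝ} (hd : Measurable Td) (hu : Measurable Tu)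
    (hg : Measurable g) : Measurable (kernelMean Td Tu g) :=
  ((measurable_upWeight hd hu).mul (hg.comp hu)).add
    ((measurable_const.sub (measurable_upWeight hd hu)).mul (hg.comp hd))

lemma upWeight_mem_Icc {Td Tu : ℝ → ℝ} {x : ℝ} (hd : Td x ≤ x) (hu : x ≤ Tu x) :
    upWeight Td Tu x ∈ Set.Icc (0 : ℝ) 1 := by
  rw [upWeight]
  split_ifs with h
  · exact ⟨div_nonneg (by linarith) (by linarith), (div_le_one (by linarith)).2 (by linarith)⟩
  · simp

/-- A convex function lies below its chord over `[T_d(x), T_u(x)]`. -/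
lemma le_kernelMean_add_slope_mul {Td Tu g : ℝ → ℝ} (hg : ConvexOn ℝ Set.univ g) {x y : ℝ}
    (hd : Td x ≤ x) (hu : x ≤ Tu x) (hy : y ∈ Set.Icc (Td x) (Tu x)) :
    g y ≤ kernelMean Td Tu g x + (g (Tu x) - g (Td x)) / (Tu x - Td x) * (y - x) := by
  rw [kernelMean, upWeight]
  split_ifs with h
  · have hpos : 0 < Tu x - Td x := sub_pos.2 h
    have hne : Tu x - Td x ≠ 0 := hpos.ne'
    have hw : (y - Td x) / (Tu x - Td x) + (Tu x - y) / (Tu x - Td x) = 1 := by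
      field_simp; ring
    have hc := hg.2 (Set.mem_univ (Tu x)) (Set.mem_univ (Td x))
      (div_nonneg (sub_nonneg.2 hy.1) hpos.le) (div_nonneg (sub_nonneg.2 hy.2) hpos.le) hw
    simp only [smul_eq_mul] at hc
    have e1 : (y - Td x) / (Tu x - Td x) * Tu x + (Tu x - y) / (Tu x - Td x) * Td x = y := by
      field_simp; ring
    rw [e1] at hc
    refine hc.trans_eq ?_
    field_simp
    ring
  -- Degenerate interval: the weight is 0 and the slope is `0 / 0 = 0`.
  · have h1 : Tu x = Td x := le_antisymm (not_lt.1 h) (hd.trans hu)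
    have h2 : y = Td x := le_antisymm (h1 ▸ hy.2) hy.1
    simp [h1, h2]

lemma lintegral_map_snd_twoGraphPlan (μ : Measure ℝ) {Td Tu : ℝ → ℝ} (hd : Measurable Td)
    (hu : Measurable Tu) {f : ℝ → ℝ≥0∞} (hf : Measurable f) :
    ∫⁻ y, f y ∂((twoGraphPlan μ Td Tu).map Prod.snd) =
      ∫⁻ x, (ENNReal.ofReal (upWeight Td Tu x) * f (Tu x) +
        ENNReal.ofReal (1 - upWeight Td Tu x) * f (Td x)) ∂μ := by
  have hq := measurable_upWeight hd hu
  have hker : Measurable fun x => ENNReal.ofReal (upWeight Td Tu x) • Measure.dirac (x, Tu x) +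
      ENNReal.ofReal (1 - upWeight Td Tu x) • Measure.dirac (x, Td x) := by
    refine Measure.measurable_of_measurable_coe _ fun s hs => ?_
    simp only [Measure.coe_add, Measure.coe_smul, Pi.add_apply, Pi.smul_apply, smul_eq_mul,
      Measure.dirac_apply' _ hs]
    have hone : Measurable (s.indicator (1 : ℝ × ℝ → ℝ≥0∞)) := measurable_one.indicator hs
    exact (hq.ennreal_ofReal.mul (hone.comp (measurable_id.prodMk hu))).add
      ((measurable_const.sub hq).ennreal_ofReal.mul (hone.comp (measurable_id.prodMk hd)))
  have hfs : Measurable fun p : ℝ × ℝ => f p.2 := hf.comp measurable_snd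
  rw [lintegral_map hf measurable_snd, twoGraphPlan,
    Measure.lintegral_bind hker.aemeasurable hfs.aemeasurable]
  refine lintegral_congr fun x => ?_
  rw [lintegral_add_measure, lintegral_smul_measure, lintegral_smul_measure,
    lintegral_dirac' _ hfs, lintegral_dirac' _ hfs, smul_eq_mul, smul_eq_mul]

lemma IsTransportPair.kernelMean_nonneg {μ : Measure ℝ} {P : Measure (ℝ × ℝ)} {D : Set ℝ}
    {Td Tu : ℝ → ℝ} (hT : IsTransportPair μ P D Td Tu) {g : ℝ → ℝ} (hg : ∀ y, 0 ≤ g y) {x : ℝ}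
    (hx : x ∈ D) : 0 ≤ kernelMean Td Tu g x := by
  have h := upWeight_mem_Icc (hT.down_le x hx) (hT.le_up x hx)
  exact add_nonneg (mul_nonneg h.1 (hg _)) (mul_nonneg (sub_nonneg.2 h.2) (hg _))

lemma IsTransportPair.integral_kernelMean {μ ν : Measure ℝ} {P : Measure (ℝ × ℝ)} {D : Set ℝ}
    {Td Tu : ℝ → ℝ} (hT : IsTransportPair μ P D Td Tu) (hν : P.map Prod.snd = ν) {g : ℝ → ℝ}
    (hgm : Measurable g) (hg : ∀ y, 0 ≤ g y) (hgi : Integrable g ν) :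
    Integrable (kernelMean Td Tu g) μ ∧ ∫ x, kernelMean Td Tu g x ∂μ = ∫ y, g y ∂ν := by
  have hD : ∀ᵐ x ∂μ, x ∈ D := hT.dom_full
  have hnn : 0 ≤ᵐ[μ] kernelMean Td Tu g := by
    filter_upwards [hD] with x hx using hT.kernelMean_nonneg hg hx
  have hm := measurable_kernelMean hT.measurable_down hT.measurable_up hgm
  have heq : ∫⁻ x, ENNReal.ofReal (kernelMean Td Tu g x) ∂μ = ∫⁻ y, ENNReal.ofReal (g y) ∂ν := by
    rw [← hν, hT.plan_eq, lintegral_map_snd_twoGraphPlan μ hT.measurable_down hT.measurable_up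
      hgm.ennreal_ofReal]
    refine lintegral_congr_ae ?_
    filter_upwards [hD] with x hx
    have h := upWeight_mem_Icc (hT.down_le x hx) (hT.le_up x hx)
    have h' := sub_nonneg.2 h.2
    rw [kernelMean, ENNReal.ofReal_add (mul_nonneg h.1 (hg _)) (mul_nonneg h' (hg _)),
      ENNReal.ofReal_mul h.1, ENNReal.ofReal_mul h']
  refine ⟨⟨hm.aestronglyMeasurable, ?_⟩, ?_⟩
  · rw [hasFiniteIntegral_iff_ofReal hnn, heq]
    exact (hasFiniteIntegral_iff_ofReal (Eventually.of_forall hg)).1 hgi.2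
  · rw [integral_eq_lintegral_of_nonneg_ae hnn hm.aestronglyMeasurable,
      integral_eq_lintegral_of_nonneg_ae (Eventually.of_forall hg) hgm.aestronglyMeasurable, heq]

/-! ### Uniform integrability through the excess function -/

/-- The excess `(|y| - K)⁺` of the absolute value over a level. -/
noncomputable def excess (K y : ℝ) : ℝ := max (|y| - K) 0

lemma excess_nonneg (K y : ℝ) : 0 ≤ excess K y := le_max_right _ _

lemma continuous_excess (K : ℝ) : Continuous (excess K) := by
  unfold excess; fun_prop

lemma excess_le_abs {K : ℝ} (hK : 0 ≤ K) (y : ℝ) : excess K y ≤ |y| :=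
  max_le (by linarith) (abs_nonneg y)

lemma convexOn_excess (K : ℝ) : ConvexOn ℝ Set.univ (excess K) := by
  have h : ConvexOn ℝ Set.univ fun y : ℝ => |y| - K :=
    (convexOn_norm (E := ℝ) convex_univ).sub (concaveOn_const K convex_univ)
  exact h.sup (convexOn_const 0 convex_univ)

lemma abs_slope_excess_le_one (K a b : ℝ) : |(excess K b - excess K a) / (b - a)| ≤ 1 := by
  rw [abs_div]
  refine div_le_one_of_le₀ ?_ (abs_nonneg _)
  refine (abs_max_sub_max_le_abs (|b| - K) (|a| - K) 0).trans ?_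
  rw [sub_sub_sub_cancel_right]
  exact abs_abs_sub_abs_le b a

lemma integrable_excess {ν : Measure ℝ} (hν : Integrable (fun x : ℝ => x) ν) {K : ℝ}
    (hK : 0 ≤ K) : Integrable (excess K) ν :=
  hν.mono (continuous_excess K).aestronglyMeasurable (Eventually.of_forall fun y => by
    rw [Real.norm_eq_abs, abs_of_nonneg (excess_nonneg K y)]
    exact excess_le_abs hK y)

lemma tendsto_integral_excess {ν : Measure ℝ} (hν : Integrable (fun x : ℝ => x) ν) :
    Tendsto (fun K : ℕ => ∫ y, excess K y ∂ν) atTop (𝓝 0) := by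
  rw [← integral_zero ℝ ℝ (μ := ν)]
  refine tendsto_integral_of_dominated_convergence (fun y => ‖y‖)
    (fun K => (continuous_excess K).aestronglyMeasurable) hν.norm
    (fun K => Eventually.of_forall fun y => ?_) (Eventually.of_forall fun y => ?_)
  · rw [Real.norm_eq_abs, abs_of_nonneg (excess_nonneg _ y)]
    exact excess_le_abs K.cast_nonneg y
  · refine tendsto_const_nhds.congr' ?_
    obtain ⟨N, hN⟩ := exists_nat_ge |y|
    filter_upwards [eventually_ge_atTop N] with K hK
    have : |y| ≤ K := hN.trans (by exact_mod_cast hK)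
    exact (max_eq_right (by linarith)).symm

/-- Where `|x| ≥ 2K` one has `|x| ≤ 2 (|x| - K)`, so the tail beyond `2K` costs at most `2 * e K`.
-/
theorem uniformIntegrable_of_integral_excess_le {Ω ι : Type*} {mΩ : MeasurableSpace Ω}
    {Q : Measure Ω} [IsProbabilityMeasure Q] {X : ι → Ω → ℝ} (hX : ∀ i, Integrable (X i) Q)
    {e : ℕ → ℝ} (he : Tendsto e atTop (𝓝 0)) (hXe : ∀ (K : ℕ) (i : ι), ∫ ω, excess K (X i ω) ∂Q ≤ e K) :
    UniformIntegrable X 1 Q := by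
  refine uniformIntegrable_of le_rfl ENNReal.one_ne_top (fun i => (hX i).aestronglyMeasurable)
    fun ε hε => ?_
  obtain ⟨K, hK⟩ := (he.eventually_lt_const (half_pos hε)).exists
  refine ⟨2 * K, fun i => ?_⟩
  have hint : Integrable (fun ω => excess K (X i ω)) Q :=
    (hX i).mono ((continuous_excess K).comp_aestronglyMeasurable (hX i).aestronglyMeasurable)
      (Eventually.of_forall fun ω => by
        rw [Real.norm_eq_abs, abs_of_nonneg (excess_nonneg _ _)]
        exact excess_le_abs K.cast_nonneg _)
  rw [eLpNorm_one_eq_lintegral_enorm]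
  calc ∫⁻ ω, ‖{ω | (2 * K : ℝ≥0) ≤ ‖X i ω‖₊}.indicator (X i) ω‖ₑ ∂Q
      ≤ ∫⁻ ω, ENNReal.ofReal (2 * excess K (X i ω)) ∂Q := by
        refine lintegral_mono fun ω => ?_
        by_cases h : ω ∈ {ω | (2 * K : ℝ≥0) ≤ ‖X i ω‖₊}
        · rw [Set.indicator_of_mem h, ← ofReal_norm]
          refine ENNReal.ofReal_le_ofReal ?_
          have h' : 2 * (K : ℝ) ≤ |X i ω| := by exact_mod_cast NNReal.coe_le_coe.2 h
          have := le_max_left (|X i ω| - K) 0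
          rw [Real.norm_eq_abs, excess]
          linarith
        · rw [Set.indicator_of_notMem h]
          simp
    _ = ENNReal.ofReal (2 * ∫ ω, excess K (X i ω) ∂Q) := by
        rw [← integral_const_mul, ofReal_integral_eq_lintegral_ofReal (hint.const_mul 2)
          (Eventually.of_forall fun ω => mul_nonneg zero_le_two (excess_nonneg _ _))]
    _ ≤ ENNReal.ofReal ε := ENNReal.ofReal_le_ofReal (by linarith [hXe K i])

end LeftMonotone

/-! ### Conclusion -/

/-- The hypothesis `h𝓕` says that every subset of the null set of those `ω` whose path is not
continuous or does not start in `D` belongs to `𝓕 0`. It holds if `𝓕 0` contains all null sets, and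
it is void (for an arbitrary filtration) if every path is continuous and starts in `D`. -/
theorem mainTheorem7
    (μ ν : Measure ℝ) [IsProbabilityMeasure μ] [IsProbabilityMeasure ν] (hatom : ∀ x : ℝ, μ {x} = 0)
    (hμ : Integrable (fun x : ℝ => x) μ) (hν : Integrable (fun x : ℝ => x) ν)
    (P : Measure (ℝ × ℝ)) (hP : LeftMonotone.IsMartingaleCoupling μ ν P)
    (hmono : LeftMonotone.IsLeftMonotone P)
    (D : Set ℝ) (Td Tu : ℝ → ℝ) (hT : LeftMonotone.IsTransportPair μ P D Td Tu)
    {Ω : Type*} {mΩ : MeasurableSpace Ω} (Q : Measure Ω) [IsProbabilityMeasure Q]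
    (𝓕 : Filtration ℝ≥0 mΩ) (B : ℝ≥0 → Ω → ℝ)
    (hB : LeftMonotone.IsBrownianMotionFrom μ B 𝓕 Q)
    (h𝓕 : ∀ A : Set Ω, A ⊆ {ω | ¬ (Continuous (fun t => B t ω) ∧ B 0 ω ∈ D)} →
      MeasurableSet[𝓕 0] A) :
    Martingale
        (stoppedProcess B (LeftMonotone.barrierTime B (LeftMonotone.barrier D Td Tu))) 𝓕 Q ∧
      UniformIntegrable
        (stoppedProcess B (LeftMonotone.barrierTime B (LeftMonotone.barrier D Td Tu))) 1 Q := by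
  have hinc := hB.hasBrownianIncrements
  have h0 : Integrable (B 0) Q := by
    have h := hμ
    rw [← hB.hasLaw_zero.map_eq] at h
    exact (integrable_map_measure h.aestronglyMeasurable hB.hasLaw_zero.aemeasurable).1 h
  have hcont : ∀ᵐ ω ∂Q, Continuous fun t => B t ω := by
    filter_upwards [hB.isBrownian.cont] with ω hω
    simpa using hω.add_const (B 0 ω)
  have hD : ∀ᵐ ω ∂Q, B 0 ω ∈ D := by
    have h : ∀ᵐ x ∂μ, x ∈ D := hT.dom_full
    rw [← hB.hasLaw_zero.map_eq] at h
    exact ae_of_ae_map hB.hasLaw_zero.aemeasurable h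
  have hτ := hT.measurableSet_lt_barrierTime hB.stronglyAdapted h𝓕
  have hmart := hinc.martingale_stoppedProcess h0 hτ hcont
    fun A hA => h𝓕 A (hA.trans fun ω hω h => hω h.1)
  refine ⟨hmart, LeftMonotone.uniformIntegrable_of_integral_excess_le hmart.integrable
    (LeftMonotone.tendsto_integral_excess hν) fun K t => ?_⟩
  set Z := stoppedProcess B (LeftMonotone.barrierTime B (LeftMonotone.barrier D Td Tu)) with hZ
  obtain ⟨hki, hke⟩ := hT.integral_kernelMean hP.map_snd
    (LeftMonotone.continuous_excess K).measurable (LeftMonotone.excess_nonneg K)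
    (LeftMonotone.integrable_excess hν K.cast_nonneg)
  set slope : ℝ → ℝ := fun x =>
    (LeftMonotone.excess K (Tu x) - LeftMonotone.excess K (Td x)) / (Tu x - Td x) with hslope
  have hslope_meas : Measurable slope := by
    have := (LeftMonotone.continuous_excess K).measurable
    exact ((this.comp hT.measurable_up).sub (this.comp hT.measurable_down)).div
      (hT.measurable_up.sub hT.measurable_down)
  -- The chord's slope is the test variable: known at time 0 and bounded by 1, it removes the linear
  -- term in expectation.
  have hzero := hinc.integral_mul_stoppedProcess_sub hτ hcont (zero_le (a := t))
    (Y := fun ω => slope (B 0 ω)) (hslope_meas.comp (hB.stronglyAdapted 0).measurable)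
    (fun ω => LeftMonotone.abs_slope_excess_le_one K _ _)
  rw [LeftMonotone.stoppedProcess_zero] at hzero
  have hslope_int : Integrable (fun ω => slope (B 0 ω) * (Z t ω - B 0 ω)) Q :=
    hzero.1.bdd_mul (hslope_meas.comp_aemeasurable hB.hasLaw_zero.aemeasurable).aestronglyMeasurable
      (Eventually.of_forall fun ω => LeftMonotone.abs_slope_excess_le_one K _ _)
  have hmean_int : Integrable
      (fun ω => LeftMonotone.kernelMean Td Tu (LeftMonotone.excess K) (B 0 ω)) Q := by
    have h := hki
    rw [← hB.hasLaw_zero.map_eq] at h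
    exact (integrable_map_measure h.aestronglyMeasurable hB.hasLaw_zero.aemeasurable).1 h
  have hmean : ∫ ω, LeftMonotone.kernelMean Td Tu (LeftMonotone.excess K) (B 0 ω) ∂Q
      = ∫ x, LeftMonotone.kernelMean Td Tu (LeftMonotone.excess K) x ∂μ :=
    hB.hasLaw_zero.integral_comp hki.aestronglyMeasurable
  calc ∫ ω, LeftMonotone.excess K (Z t ω) ∂Q
      ≤ ∫ ω, (LeftMonotone.kernelMean Td Tu (LeftMonotone.excess K) (B 0 ω)
          + slope (B 0 ω) * (Z t ω - B 0 ω)) ∂Q := by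
        refine integral_mono_of_nonneg
          (Eventually.of_forall fun ω => LeftMonotone.excess_nonneg _ _)
          (hmean_int.add hslope_int) ?_
        filter_upwards [hcont, hD] with ω hω hωD
        exact LeftMonotone.le_kernelMean_add_slope_mul (LeftMonotone.convexOn_excess K)
          (hT.down_le _ hωD) (hT.le_up _ hωD) (hT.stoppedProcess_mem_Icc hω hωD t)
    _ = ∫ y, LeftMonotone.excess K y ∂ν := by
        rw [integral_add hmean_int hslope_int, hzero.2, add_zero, hmean, hke]
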